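/- Let $j=\sqrt{-1}$, let $A,E$ be real $n\times n$ matrices, let $\omega_1,\omega_2\in\mathbb R$, and let $\alpha,\beta\in\mathbb C$ be such that $W:=\alpha E+\beta A$ is invertible (such $\alpha,\beta$ exist exactly when the pencil $(A,E)$ is regular). Assume that $\det(A-j\lambda E)\neq 0$ for every $\lambda$ in the closed interval with endpoints $\omega_1$ and $\omega_2$. Put $K(s):=(sE-A)^{-1}$ and, for $\varepsilon\in\mathbb C$ and $\omega\in\mathbb R$, $$A_\varepsilon:=A+\alpha\varepsilon I,\qquad E_\varepsilon:=E-\beta\varepsilon I,\qquad \tilde\Omega(\omega,\varepsilon):=\omega E_\varepsilon+jA_\varepsilon .$$ Let $\log$ denote the principal matrix logarithm: if $X\in\mathbb C^{n\times n}$ has no eigenvalue on the closed negative real axis $(-\infty,0]$, then $\log X$ is the unique matrix $Q$ with $e^Q=X$ all of whose eigenvalues satisfy $-\pi<\operatorname{Im} z<\pi$. Let $\psi_1(X):=\sum_{i=0}^{\infty}\frac{1}{(i+1)!}X^i$, and $$\tilde Y_\varepsilon:=\log\bigl(\tilde\Omega(\omega_2,\varepsilon)\tilde\Omega(\omega_1,\varepsilon)^{-1}\bigr),\qquad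 \tilde Y:=\log\bigl(\tilde\Omega(\omega_2,0)\tilde\Omega(\omega_1,0)^{-1}\bigr),\qquad \tilde L:=\psi_1(\tilde Y)^{-1}.$$ Then $\omega\mapsto K(j\omega)$ is integrable on the interval from $\omega_1$ to $\omega_2$; for all sufficiently small $\varepsilon\neq0$ the matrices $E_\varepsilon$ and $\tilde\Omega(\omega_1,\varepsilon)$ are invertible and the principal logarithms of $\tilde\Omega(\omega_2,\varepsilon)\tilde\Omega(\omega_1,\varepsilon)^{-1}$ and $\tilde\Omega(\omega_1,\varepsilon)^{-1}\tilde\Omega(\omega_2,\varepsilon)$ exist; the matrices $\tilde Y$ and $\tilde L$ are well defined (that is, $\tilde\Omega(\omega_1,0)$ and $\psi_1(\tilde Y)$ are invertible and the logarithm defining $\tilde Y$ exists); and $$\begin{aligned}\int_{\omega_1}^{\omega_2}K(j\omega)\,d\omega &=\lim_{\varepsilon\to0}\frac1j E_\varepsilon^{-1}\log\bigl(\tilde\Omega(\omega_2,\varepsilon)\tilde\Omega(\omega_1,\varepsilon)^{-1}\bigr)\\ &=\lim_{\varepsilon\to0}\frac1j \log\bigl(\tilde\Omega(\omega_1,\varepsilon)^{-1}\tilde\Omega(\omega_2,\varepsilon)\bigr)E_\varepsilon^{-1}\\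 &=-W^{-1}\bigl(\beta\tilde L(\omega_2I-e^{\tilde Y}\omega_1)+j\alpha\tilde Y\bigr),\end{aligned}$$ where $\varepsilon\to 0$ through nonzero complex numbers and both limits exist. Moreover $\tilde Y=\lim_{\varepsilon\to0}\tilde Y_\varepsilon$, and if $\omega_1\neq\omega_2$, then $e^{\tilde Y_\varepsilon}-I$ is invertible for all sufficiently small $\varepsilon\ne0$ and $\tilde L=\lim_{\varepsilon\to0}(e^{\tilde Y_\varepsilon}-I)^{-1}\tilde Y_\varepsilon$. -/

import Mathlib

open scoped Topology Nat

noncomputable section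

namespace DescriptorPencil

variable {n : ℕ}

/-- A real square matrix, regarded as a complex matrix. -/
abbrev toC (M : Matrix (Fin n) (Fin n) ℝ) : Matrix (Fin n) (Fin n) ℂ :=
  M.map (fun x : ℝ => (x : ℂ))

/-- The set of (finite) eigenvalues of the matrix pencil `(A, E)`: the complex numbers `z` with
`det (A - z E) = 0`. -/
def eigenvalues (A E : Matrix (Fin n) (Fin n) ℂ) : Set ℂ :=
  {z | (A - z • E).det = 0}

/-- `W = α E + β A`. The pencil `(A, E)` is regular iff this is invertible for some `α`, `β`. -/
def W (A E : Matrix (Fin n) (Fin n) ℂ) (α β : ℂ) : Matrix (Fin n) (Fin n) ℂ :=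
  α • E + β • A

/-- The transfer function `K(s) = (s E - A)⁻¹`. -/
def K (A E : Matrix (Fin n) (Fin n) ℂ) (s : ℂ) : Matrix (Fin n) (Fin n) ℂ :=
  (s • E - A)⁻¹

/-- The integral of a matrix-valued function over an interval, entry by entry. -/
def matrixIntegral (F : ℝ → Matrix (Fin n) (Fin n) ℂ) (a b : ℝ) : Matrix (Fin n) (Fin n) ℂ :=
  Matrix.of fun i k => ∫ ω in a..b, F ω i k

/-- The perturbed matrix `A_ε = A + α ε I`. -/
def Aeps (A : Matrix (Fin n) (Fin n) ℂ) (α ε : ℂ) : Matrix (Fin n) (Fin n) ℂ :=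
  A + (α * ε) • (1 : Matrix (Fin n) (Fin n) ℂ)

/-- The perturbed matrix `E_ε = E - β ε I`. -/
def Eeps (E : Matrix (Fin n) (Fin n) ℂ) (β ε : ℂ) : Matrix (Fin n) (Fin n) ℂ :=
  E - (β * ε) • (1 : Matrix (Fin n) (Fin n) ℂ)

/-- `Ω(ω, ε) = ω E_ε + j A_ε`. -/
def Omega (A E : Matrix (Fin n) (Fin n) ℂ) (α β : ℂ) (ω : ℝ) (ε : ℂ) :
    Matrix (Fin n) (Fin n) ℂ :=
  (ω : ℂ) • Eeps E β ε + Complex.I • Aeps A α ε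

/-- `Q` is a principal logarithm of `X`: `e ^ Q = X` and every eigenvalue of `Q` lies in the open
strip `-π < Im z < π`. -/
def IsPrincipalLog (X Q : Matrix (Fin n) (Fin n) ℂ) : Prop :=
  NormedSpace.exp Q = X ∧ ∀ μ ∈ spectrum ℂ Q, -Real.pi < μ.im ∧ μ.im < Real.pi

/-- `X` has a well-defined principal logarithm: no eigenvalue of `X` lies on the closed negative
real axis, and exactly one logarithm of `X` has all its eigenvalues in the open strip. -/
def HasPrincipalLog (X : Matrix (Fin n) (Fin n) ℂ) : Prop :=
  (∀ μ ∈ spectrum ℂ X, μ ∈ Complex.slitPlane) ∧ ∃! Q, IsPrincipalLog X Q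

open Classical in
/-- The principal logarithm of `X` (with the value `0` where there is none). -/
def principalLog (X : Matrix (Fin n) (Fin n) ℂ) : Matrix (Fin n) (Fin n) ℂ :=
  if h : ∃ Q, IsPrincipalLog X Q then h.choose else 0

theorem HasPrincipalLog.isPrincipalLog {X : Matrix (Fin n) (Fin n) ℂ} (h : HasPrincipalLog X) :
    IsPrincipalLog X (principalLog X) := by
  have h' : ∃ Q, IsPrincipalLog X Q := h.2.exists
  unfold principalLog
  rw [dif_pos h']
  exact h'.choose_spec

/-- `ψ₁(X) = ∑_{j ≥ 0} X ^ j / (j + 1)!`. -/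
def psi1 (X : Matrix (Fin n) (Fin n) ℂ) : Matrix (Fin n) (Fin n) ℂ :=
  ∑' j : ℕ, (((j + 1)! : ℕ) : ℂ)⁻¹ • X ^ j

/-- `Y_ε = log (Ω(ω₂, ε) Ω(ω₁, ε)⁻¹)`. -/
def Yeps (A E : Matrix (Fin n) (Fin n) ℂ) (α β : ℂ) (ω₁ ω₂ : ℝ) (ε : ℂ) :
    Matrix (Fin n) (Fin n) ℂ :=
  principalLog (Omega A E α β ω₂ ε * (Omega A E α β ω₁ ε)⁻¹)

/-- `Y = log (Ω(ω₂, 0) Ω(ω₁, 0)⁻¹)`. -/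
def Ylim (A E : Matrix (Fin n) (Fin n) ℂ) (α β : ℂ) (ω₁ ω₂ : ℝ) :
    Matrix (Fin n) (Fin n) ℂ :=
  Yeps A E α β ω₁ ω₂ 0

/-- `L = ψ₁(Y)⁻¹`. -/
def L (A E : Matrix (Fin n) (Fin n) ℂ) (α β : ℂ) (ω₁ ω₂ : ℝ) :
    Matrix (Fin n) (Fin n) ℂ :=
  (psi1 (Ylim A E α β ω₁ ω₂))⁻¹

end DescriptorPencil

end

namespace DescriptorPencil

/-! Since `Ω` is affine in `ω` with slope `E_ε`, one has `Ω(ω₂)Ω(ω₁)⁻¹ = 1 + C` with `C = (ω₂ - ω₁)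
E_ε Ω(ω₁)⁻¹`, and the hypothesis on eigenvalues says, at `ε = 0`, that the whole segment `1 + sC`,
`0 ≤ s ≤ 1`, is invertible; this persists for small `ε`. For such `C` put `D = ∫₀¹ (1 + sC)⁻¹ ds`.
Then `C * D` is the principal logarithm of `1 + C`, while `(ω₂ - ω₁) Ω(ω₁)⁻¹ D` is the integral of
`Ω⁻¹`. So the logarithm is `E_ε` times the integral, and `E_ε⁻¹` cancels.

Because `D` is continuous in `C` even where `C` is singular, the limits exist although `E` may be
singular. Moreover `D = ψ₁(C * D)⁻¹`, so `D` at `ε = 0` is `L`; the limit-free formula is then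
linear algebra. The main lemmas are `SegmentUnits.exp_mul_resolventMean`,
`SegmentUnits.eq_of_isPrincipalLog`, `SegmentUnits.resolventMean_mul_expQuotient` and
`matrixIntegral_K`. -/

theorem segment_mem_slitPlane {c : ℂ} (hc : 1 + c ∈ Complex.slitPlane) {s : ℝ}
    (hs : s ∈ Set.Icc (0 : ℝ) 1) : 1 + (s : ℂ) * c ∈ Complex.slitPlane := by
  have := Complex.starConvex_one_slitPlane hc (sub_nonneg.mpr hs.2) hs.1 (by ring)
  convert this using 1
  simp only [Complex.real_smul, Complex.ofReal_sub, Complex.ofReal_one]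
  ring

theorem mul_integral_inv_segment {c : ℂ} (hc : 1 + c ∈ Complex.slitPlane) :
    c * ∫ s in (0 : ℝ)..1, (1 + (s : ℂ) * c)⁻¹ = Complex.log (1 + c) := by
  rw [← intervalIntegral.integral_const_mul,
    intervalIntegral.integral_eq_sub_of_hasDerivAt
      (f := fun s : ℝ => Complex.log (1 + (s : ℂ) * c))]
  · simp
  · intro s hs
    rw [Set.uIcc_of_le zero_le_one] at hs
    have h1 : HasDerivAt (fun t : ℝ => 1 + (t : ℂ) * c) c s := by
      simpa using ((Complex.ofRealCLM.hasDerivAt (x := s)).mul_const c).const_add 1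
    simpa [div_eq_mul_inv] using h1.clog_real (segment_mem_slitPlane hc hs)
  · refine ContinuousOn.intervalIntegrable ?_
    rw [Set.uIcc_of_le zero_le_one]
    exact continuousOn_const.mul (ContinuousOn.inv₀ (by fun_prop)
      fun s hs => Complex.slitPlane_ne_zero (segment_mem_slitPlane hc hs))

/-! ### Logarithms along a segment of units in a Banach algebra. -/

section BanachAlgebra

variable {𝔸 : Type*} [NormedRing 𝔸] [NormedAlgebra ℂ 𝔸]

/-- The mean `∫₀¹ (1 + s C)⁻¹ ds`, so that `C * resolventMean C` is a logarithm of `1 + C`. -/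
noncomputable def resolventMean (C : 𝔸) : 𝔸 := ∫ s in (0 : ℝ)..1, Ring.inverse (1 + (s : ℂ) • C)

/-- The segment from `1` to `1 + C` consists of units. -/
def SegmentUnits (C : 𝔸) : Prop := ∀ s ∈ Set.Icc (0 : ℝ) 1, IsUnit (1 + (s : ℂ) • C)

/-- The entire function `∑ x ^ j / (j + 1)!` on a Banach algebra. -/
noncomputable def expQuotient (x : 𝔸) : 𝔸 := ∑' j : ℕ, (((j + 1)! : ℕ) : ℂ)⁻¹ • x ^ j

/-- `‖1‖ = 1` is not assumed; the factor `‖1‖ + 1` covers the term `j = 0`. -/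
theorem norm_expQuotient_term_le (x : 𝔸) (j : ℕ) :
    ‖(((j + 1)! : ℕ) : ℂ)⁻¹ • x ^ j‖ ≤ (‖(1 : 𝔸)‖ + 1) * (‖x‖ ^ j / (j ! : ℝ)) := by
  rw [norm_smul, norm_inv, Complex.norm_natCast]
  have h1 : ‖x ^ j‖ ≤ (‖(1 : 𝔸)‖ + 1) * ‖x‖ ^ j := by
    rcases Nat.eq_zero_or_pos j with rfl | hj
    · simp
    · refine (norm_pow_le' x hj).trans (le_mul_of_one_le_left (by positivity) ?_)
      linarith [norm_nonneg (1 : 𝔸)]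
  have h2 : (((j + 1)! : ℕ) : ℝ)⁻¹ ≤ ((j ! : ℕ) : ℝ)⁻¹ := by
    apply inv_anti₀ (by positivity)
    exact_mod_cast Nat.factorial_le (Nat.le_succ j)
  calc _ ≤ ((j ! : ℕ) : ℝ)⁻¹ * ((‖(1 : 𝔸)‖ + 1) * ‖x‖ ^ j) := by gcongr
    _ = _ := by ring

theorem commute_inverse_segment {C P : 𝔸} (hP : Commute P C) (s : ℂ) :
    Commute P (Ring.inverse (1 + s • C)) := by
  have h : Commute P (1 + s • C) := (Commute.one_right P).add_right (hP.smul_right s)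
  by_cases hu : IsUnit (1 + s • C)
  · obtain ⟨u, hu⟩ := hu
    rw [← hu] at h ⊢
    rw [Ring.inverse_unit]
    exact h.units_inv_right
  · rw [Ring.inverse_non_unit _ hu]
    exact Commute.zero_right P

/-- The "eigenvector" `v` is an element of the algebra, so that spectral arguments need no module;
for matrices it will have rank one. -/
theorem inverse_segment_mul {C v : 𝔸} {c s : ℂ} (hv : C * v = c • v)
    (hu : IsUnit (1 + s • C)) (hc : 1 + s * c ≠ 0) :
    Ring.inverse (1 + s • C) * v = (1 + s * c)⁻¹ • v := by
  have h1 : (1 + s • C) * v = (1 + s * c) • v := by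
    rw [add_mul, one_mul, smul_mul_assoc, hv, smul_smul, add_smul, one_smul]
  have h2 : (1 + s • C) * ((1 + s * c)⁻¹ • v) = v := by
    rw [mul_smul_comm, h1, smul_smul, inv_mul_cancel₀ hc, one_smul]
  conv_lhs => rw [← h2, ← mul_assoc, Ring.inverse_mul_cancel _ hu, one_mul]

theorem one_add_smul_conj (u : 𝔸ˣ) (C : 𝔸) (s : ℂ) :
    1 + s • (↑u⁻¹ * C * ↑u) = ↑u⁻¹ * (1 + s • C) * (↑u : 𝔸) := by
  rw [mul_add, mul_one, add_mul, Units.inv_mul, mul_smul_comm, smul_mul_assoc]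

theorem SegmentUnits.conj {C : 𝔸} (h : SegmentUnits C) (u : 𝔸ˣ) :
    SegmentUnits (↑u⁻¹ * C * ↑u : 𝔸) := fun s hs => by
  rw [one_add_smul_conj]
  exact (u⁻¹.isUnit.mul (h s hs)).mul u.isUnit

variable [CompleteSpace 𝔸]

theorem continuousAt_inverse_segment {C : 𝔸} {s : ℝ} (h : IsUnit (1 + (s : ℂ) • C)) :
    ContinuousAt (fun p : 𝔸 × ℝ => Ring.inverse (1 + (p.2 : ℂ) • p.1)) (C, s) := by
  obtain ⟨u, hu⟩ := h
  have h1 : ContinuousAt Ring.inverse (1 + (((C, s) : 𝔸 × ℝ).2 : ℂ) • ((C, s) : 𝔸 × ℝ).1) := by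
    simpa only [← hu] using NormedRing.inverse_continuousAt u
  exact ContinuousAt.comp (f := fun p : 𝔸 × ℝ => 1 + (p.2 : ℂ) • p.1) h1
    (by fun_prop)

theorem SegmentUnits.continuousOn {C : 𝔸} (h : SegmentUnits C) :
    ContinuousOn (fun s : ℝ => Ring.inverse (1 + (s : ℂ) • C)) (Set.Icc 0 1) := by
  intro s hs
  exact (ContinuousAt.comp (f := fun s : ℝ => (C, s)) (continuousAt_inverse_segment (h s hs))
    (by fun_prop)).continuousWithinAt

theorem SegmentUnits.intervalIntegrable {C : 𝔸} (h : SegmentUnits C) :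
    IntervalIntegrable (fun s : ℝ => Ring.inverse (1 + (s : ℂ) • C)) MeasureTheory.volume 0 1 := by
  apply ContinuousOn.intervalIntegrable
  rw [Set.uIcc_of_le zero_le_one]
  exact h.continuousOn

/-- Units are open and `[0, 1]` is compact. -/
theorem SegmentUnits.eventually {C : 𝔸} (h : SegmentUnits C) :
    ∀ᶠ C' in 𝓝 C, SegmentUnits C' := by
  refine isCompact_Icc.eventually_forall_of_forall_eventually fun s hs => ?_
  have hc : ContinuousAt (fun p : 𝔸 × ℝ => 1 + (p.2 : ℂ) • p.1) (C, s) := by fun_prop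
  exact hc.eventually (Units.isOpen.mem_nhds (h s hs))

/-- Dominated convergence: compactness of `[0, 1]` bounds the integrand uniformly for all nearby
`C'`. -/
theorem SegmentUnits.continuousAt_resolventMean {C : 𝔸} (h : SegmentUnits C) :
    ContinuousAt (resolventMean : 𝔸 → 𝔸) C := by
  obtain ⟨M, hM⟩ := isCompact_Icc.exists_bound_of_continuousOn h.continuousOn
  refine intervalIntegral.continuousAt_of_dominated_interval (bound := fun _ => M + 1) ?_ ?_ ?_ ?_
  · filter_upwards [h.eventually] with C' h'
    exact h'.intervalIntegrable.aestronglyMeasurable_restrict_uIoc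
  · have : ∀ᶠ C' in 𝓝 C, ∀ s ∈ Set.Icc (0 : ℝ) 1,
        ‖Ring.inverse (1 + (s : ℂ) • C')‖ < M + 1 := by
      refine isCompact_Icc.eventually_forall_of_forall_eventually fun s hs => ?_
      exact (continuousAt_inverse_segment (h s hs)).norm.eventually_lt continuousAt_const
        (by linarith [hM s hs])
    filter_upwards [this] with C' h'
    refine Filter.Eventually.of_forall fun s hs => (h' s ?_).le
    rw [Set.uIoc_of_le zero_le_one] at hs
    exact ⟨hs.1.le, hs.2⟩
  · exact intervalIntegrable_const
  · refine Filter.Eventually.of_forall fun s hs => ?_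
    rw [Set.uIoc_of_le zero_le_one] at hs
    exact ContinuousAt.comp (f := fun C : 𝔸 => (C, s))
      (continuousAt_inverse_segment (h s ⟨hs.1.le, hs.2⟩)) (by fun_prop)

theorem commute_intervalIntegral {f : ℝ → 𝔸} {P : 𝔸} (a b : ℝ) (h : ∀ s, Commute P (f s))
    (hf : IntervalIntegrable f MeasureTheory.volume a b) :
    Commute P (∫ s in a..b, f s) := by
  have h1 := (ContinuousLinearMap.mul ℝ 𝔸 P).intervalIntegral_comp_comm hf
  have h2 := ((ContinuousLinearMap.mul ℝ 𝔸).flip P).intervalIntegral_comp_comm hf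
  simp only [ContinuousLinearMap.mul_apply', ContinuousLinearMap.flip_apply] at h1 h2
  rw [Commute, SemiconjBy, ← h1, ← h2]
  exact intervalIntegral.integral_congr fun s _ => (h s).eq

theorem SegmentUnits.commute_resolventMean {C P : 𝔸} (h : SegmentUnits C) (hP : Commute P C) :
    Commute P (resolventMean C) :=
  commute_intervalIntegral 0 1 (fun s => commute_inverse_segment hP s) h.intervalIntegrable

/-- Commutation gives `exp (F s) = exp (F t) * exp (F s - F t)`, so only the derivative of `exp` at
`0` is needed. -/
theorem hasDerivAt_exp_of_commute {F : ℝ → 𝔸} {F' : 𝔸} {t : ℝ}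
    (hF : HasDerivAt F F' t) (hc : ∀ s, Commute (F t) (F s)) :
    HasDerivAt (fun s => NormedSpace.exp (F s)) (NormedSpace.exp (F t) * F') t := by
  let : NormedAlgebra ℚ 𝔸 := NormedAlgebra.restrictScalars ℚ ℂ 𝔸
  have h0 : HasFDerivAt (NormedSpace.exp : 𝔸 → 𝔸) (1 : 𝔸 →L[ℝ] 𝔸) (F t - F t) := by
    rw [sub_self]; exact hasFDerivAt_exp_zero
  have h1 := (h0.comp_hasDerivAt t (hF.sub_const (F t))).const_mul (NormedSpace.exp (F t))
  refine h1.congr_of_eventuallyEq (Filter.Eventually.of_forall fun s => ?_)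
  change NormedSpace.exp (F s) = NormedSpace.exp (F t) * NormedSpace.exp (F s - F t)
  rw [← NormedSpace.exp_add_of_commute ((hc s).sub_right (Commute.refl _))]
  congr 1
  abel

/-- The function `exp (-C ∫₀ᵗ (1 + sC)⁻¹ ds) * (1 + tC)` has derivative zero on `[0, 1)` and value
`1` at `t = 0`; compare with `t = 1`. -/
theorem SegmentUnits.exp_mul_resolventMean {C : 𝔸} (h : SegmentUnits C) :
    NormedSpace.exp (C * resolventMean C) = 1 + C := by
  let : NormedAlgebra ℚ 𝔸 := NormedAlgebra.restrictScalars ℚ ℂ 𝔸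
  set f : ℝ → 𝔸 := fun s => Ring.inverse (1 + (s : ℂ) • C) with hf
  -- Extending by the endpoint values makes the integrand continuous on all of `ℝ`, so its primitive
  -- is differentiable everywhere.
  set g : ℝ → 𝔸 := Set.IccExtend zero_le_one ((Set.Icc (0 : ℝ) 1).domRestrict f) with hg
  have hgf : ∀ s ∈ Set.Icc (0 : ℝ) 1, g s = f s := fun s hs => by
    rw [hg, Set.IccExtend_of_mem _ _ hs]; rfl
  have hgc : Continuous g := (continuousOn_iff_continuous_domRestrict.mp h.continuousOn).Icc_extend'
  have hcom : ∀ P : 𝔸, Commute P C → ∀ s, Commute P (g s) := fun P hP s =>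
    commute_inverse_segment hP _
  set F : ℝ → 𝔸 := fun t => -(C * ∫ s in (0 : ℝ)..t, g s) with hF
  have hint : ∀ t, Commute C (∫ s in (0 : ℝ)..t, g s) := fun t =>
    commute_intervalIntegral 0 t (hcom C (Commute.refl C)) (hgc.intervalIntegrable _ _)
  have hFC : ∀ t, Commute C (F t) := fun t =>
    ((Commute.refl C).mul_right (hint t)).neg_right
  have hFF : ∀ t u, Commute (F t) (F u) := fun t u => by
    refine Commute.neg_right (Commute.mul_right (hFC t).symm ?_)
    exact commute_intervalIntegral 0 u (hcom _ (hFC t).symm) (hgc.intervalIntegrable _ _)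
  have hFd : ∀ t, HasDerivAt F (-(C * g t)) t := fun t =>
    ((intervalIntegral.integral_hasDerivAt_right (hgc.intervalIntegrable _ _)
      hgc.stronglyMeasurable.stronglyMeasurableAtFilter hgc.continuousAt).const_mul C).neg
  set G : ℝ → 𝔸 := fun t => NormedSpace.exp (F t) * (1 + (t : ℂ) • C) with hG
  have hlin : ∀ t : ℝ, HasDerivAt (fun t : ℝ => 1 + (t : ℂ) • C) C t := fun t => by
    have := ((Complex.ofRealCLM.hasDerivAt (x := t)).smul_const C).const_add 1
    simpa using this
  have hGd : ∀ t, HasDerivAt G (NormedSpace.exp (F t) * (-(C * g t)) * (1 + (t : ℂ) • C) +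
      NormedSpace.exp (F t) * C) t := fun t =>
    (hasDerivAt_exp_of_commute (hFd t) (hFF t)).mul (hlin t)
  have hGz : ∀ t ∈ Set.Ico (0 : ℝ) 1, HasDerivWithinAt G 0 (Set.Ici t) t := fun t ht => by
    have ht' : t ∈ Set.Icc (0 : ℝ) 1 := ⟨ht.1, ht.2.le⟩
    have hz := (hGd t).hasDerivWithinAt (s := Set.Ici t)
    rwa [hgf t ht', mul_assoc, neg_mul, mul_assoc C, Ring.inverse_mul_cancel _ (h t ht'),
      mul_one, mul_neg, neg_add_cancel] at hz
  have hconst := constant_of_has_deriv_right_zero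
    (fun t _ => (hGd t).continuousAt.continuousWithinAt) hGz 1 ⟨zero_le_one, le_rfl⟩
  have hF1 : F 1 = -(C * resolventMean C) := by
    simp only [hF, resolventMean]
    congr 2
    refine intervalIntegral.integral_congr fun s hs => ?_
    rw [Set.uIcc_of_le zero_le_one] at hs
    exact hgf s hs
  have hF0 : F 0 = 0 := by simp [hF]
  simp only [hG, hF1, hF0, NormedSpace.exp_zero, Complex.ofReal_one, one_smul,
    Complex.ofReal_zero, zero_smul, add_zero, mul_one] at hconst
  have hinv : NormedSpace.exp (C * resolventMean C) * NormedSpace.exp (-(C * resolventMean C))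
      = 1 := by
    rw [← NormedSpace.exp_add_of_commute (Commute.neg_right (Commute.refl _))]
    simp
  calc NormedSpace.exp (C * resolventMean C)
      = NormedSpace.exp (C * resolventMean C) *
        (NormedSpace.exp (-(C * resolventMean C)) * (1 + C)) := by rw [hconst, mul_one]
    _ = 1 + C := by rw [← mul_assoc, hinv, one_mul]

/-! ### The function `ψ₁` and its inverse value. -/

theorem summable_expQuotient (x : 𝔸) :
    Summable fun j : ℕ => (((j + 1)! : ℕ) : ℂ)⁻¹ • x ^ j :=
  Summable.of_norm_bounded ((Real.summable_pow_div_factorial ‖x‖).mul_left (‖(1 : 𝔸)‖ + 1))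
    (norm_expQuotient_term_le x)

theorem continuous_expQuotient : Continuous (expQuotient : 𝔸 → 𝔸) := by
  rw [continuous_iff_continuousAt]
  intro x
  have hon : ContinuousOn (expQuotient : 𝔸 → 𝔸) (Metric.ball 0 (‖x‖ + 1)) := by
    refine continuousOn_tsum (u := fun j => (‖(1 : 𝔸)‖ + 1) * ((‖x‖ + 1) ^ j / (j ! : ℝ)))
      (fun j => by fun_prop)
      ((Real.summable_pow_div_factorial (‖x‖ + 1)).mul_left (‖(1 : 𝔸)‖ + 1)) fun j y hy => ?_
    refine (norm_expQuotient_term_le y j).trans ?_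
    have : ‖y‖ ≤ ‖x‖ + 1 := by simpa using (mem_ball_zero_iff.mp hy).le
    gcongr
  exact hon.continuousAt (Metric.isOpen_ball.mem_nhds (by simp))

theorem mul_expQuotient (x : 𝔸) : x * expQuotient x = NormedSpace.exp x - 1 := by
  have hs := NormedSpace.expSeries_summable' (𝕂 := ℂ) x
  rw [NormedSpace.exp_eq_tsum ℂ]
  simp only
  rw [hs.tsum_eq_zero_add, expQuotient, ← (summable_expQuotient x).tsum_mul_left]
  simp [pow_succ']

/-- With `Y = C * D`, the identity `Y ψ₁(Y) = exp Y - 1` reads `C * D * ψ₁(Y) = C`; cancel `C`. -/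
theorem expQuotient_mul_resolventMean_of_isUnit {C : 𝔸} (h : SegmentUnits C) (hC : IsUnit C) :
    resolventMean C * expQuotient (C * resolventMean C) = 1 := by
  have h1 := mul_expQuotient (C * resolventMean C)
  rw [h.exp_mul_resolventMean, add_sub_cancel_left, mul_assoc] at h1
  exact hC.mul_left_cancel (by rw [h1, mul_one])

/-- A singular `C` is approached through the invertible `C + z`, and both factors are continuous. -/
theorem SegmentUnits.resolventMean_mul_expQuotient {C : 𝔸} (h : SegmentUnits C)
    (hC : ∀ᶠ z in 𝓝[≠] (0 : ℂ), IsUnit (C + z • (1 : 𝔸))) :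
    resolventMean C * expQuotient (C * resolventMean C) = 1 := by
  have hp : Filter.Tendsto (fun z : ℂ => C + z • (1 : 𝔸)) (𝓝[≠] 0) (𝓝 C) := by
    have : ContinuousAt (fun z : ℂ => C + z • (1 : 𝔸)) 0 := by fun_prop
    simpa [ContinuousAt] using this.tendsto.mono_left nhdsWithin_le_nhds
  have hD := h.continuousAt_resolventMean.tendsto.comp hp
  have hlim := hD.mul ((continuous_expQuotient.tendsto _).comp (hp.mul hD))
  refine tendsto_nhds_unique (hlim.congr' ?_) tendsto_const_nhds
  filter_upwards [hp.eventually h.eventually, hC] with z hz hu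
  exact expQuotient_mul_resolventMean_of_isUnit hz hu

theorem expQuotient_apply_of_mul_eq_zero {N v : 𝔸} (hv : N * v = 0) :
    expQuotient N * v = v := by
  rw [expQuotient, ← (summable_expQuotient N).tsum_mul_right, tsum_eq_single 0]
  · simp
  · intro j hj
    obtain ⟨k, rfl⟩ := Nat.exists_eq_succ_of_ne_zero hj
    rw [smul_mul_assoc, pow_succ, mul_assoc, hv, mul_zero, smul_zero]

theorem exp_mul_of_mul_eq_smul {Q v : 𝔸} {q : ℂ} (hv : Q * v = q • v) :
    NormedSpace.exp Q * v = Complex.exp q • v := by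
  have hpow : ∀ j : ℕ, Q ^ j * v = q ^ j • v := by
    intro j
    induction j with
    | zero => simp
    | succ k ih => rw [pow_succ, mul_assoc, hv, mul_smul_comm, ih, smul_smul, pow_succ']
  rw [Complex.exp_eq_exp_ℂ, NormedSpace.exp_eq_tsum ℂ, NormedSpace.exp_eq_tsum ℂ]
  simp only
  rw [← (NormedSpace.expSeries_summable' (𝕂 := ℂ) Q).tsum_mul_right,
    ← (NormedSpace.expSeries_summable' (𝕂 := ℂ) q).tsum_smul_const]
  refine tsum_congr fun j => ?_
  rw [smul_mul_assoc, hpow, smul_eq_mul, smul_smul]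

theorem SegmentUnits.log_mul {C v : 𝔸} {c : ℂ} (h : SegmentUnits C) (hv : C * v = c • v)
    (hc : 1 + c ∈ Complex.slitPlane) :
    C * resolventMean C * v = Complex.log (1 + c) • v := by
  have h1 := ((ContinuousLinearMap.mul ℝ 𝔸).flip v).intervalIntegral_comp_comm
    h.intervalIntegrable
  simp only [ContinuousLinearMap.mul_apply', ContinuousLinearMap.flip_apply] at h1
  have h2 : resolventMean C * v = (∫ s in (0 : ℝ)..1, (1 + (s : ℂ) * c)⁻¹) • v := by
    rw [resolventMean, ← h1, ← intervalIntegral.integral_smul_const]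
    refine intervalIntegral.integral_congr fun s hs => ?_
    rw [Set.uIcc_of_le zero_le_one] at hs
    exact inverse_segment_mul hv (h s hs) (Complex.slitPlane_ne_zero (segment_mem_slitPlane hc hs))
  rw [mul_assoc, h2, mul_smul_comm, hv, smul_smul, mul_comm, mul_integral_inv_segment hc]

theorem SegmentUnits.resolventMean_conj {C : 𝔸} (h : SegmentUnits C) (u : 𝔸ˣ) :
    resolventMean (↑u⁻¹ * C * ↑u : 𝔸) = ↑u⁻¹ * resolventMean C * ↑u := by
  have h1 := (((ContinuousLinearMap.mul ℝ 𝔸).flip (u : 𝔸)).comp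
    (ContinuousLinearMap.mul ℝ 𝔸 (↑u⁻¹ : 𝔸))).intervalIntegral_comp_comm h.intervalIntegrable
  simp only [ContinuousLinearMap.comp_apply, ContinuousLinearMap.mul_apply',
    ContinuousLinearMap.flip_apply] at h1
  rw [resolventMean, resolventMean, ← h1]
  refine intervalIntegral.integral_congr fun s hs => ?_
  rw [Set.uIcc_of_le zero_le_one] at hs
  obtain ⟨v, hv⟩ := h s hs
  have h2 : 1 + (s : ℂ) • (↑u⁻¹ * C * ↑u) = ((u⁻¹ * v * u : 𝔸ˣ) : 𝔸) := by
    rw [one_add_smul_conj, ← hv]; rfl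
  rw [h2, ← hv, Ring.inverse_unit, Ring.inverse_unit]
  simp [mul_assoc]

theorem exp_sub_eq_one {Q Y : 𝔸} (hQY : Commute Q Y)
    (h : NormedSpace.exp Q = NormedSpace.exp Y) : NormedSpace.exp (Q - Y) = 1 := by
  let : NormedAlgebra ℚ 𝔸 := NormedAlgebra.restrictScalars ℚ ℂ 𝔸
  rw [sub_eq_add_neg, NormedSpace.exp_add_of_commute hQY.neg_right, h,
    ← NormedSpace.exp_add_of_commute (Commute.neg_right (Commute.refl Y)), add_neg_cancel,
    NormedSpace.exp_zero]

theorem exp_eigenvalue_eq {Q Y V : 𝔸} {q y : ℂ} (h : NormedSpace.exp Q = NormedSpace.exp Y)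
    (hV : V ≠ 0) (hq : Q * V = q • V) (hy : Y * V = y • V) : Complex.exp q = Complex.exp y := by
  refine smul_left_injective ℂ hV ?_
  change _ • V = _ • V
  rw [← exp_mul_of_mul_eq_smul hq, ← exp_mul_of_mul_eq_smul hy, h]

end BanachAlgebra

/-! ### Common eigenvectors and generic invertibility. -/

section Matrices

variable {n : ℕ}

theorem exists_common_eigenvector {P Q : Matrix (Fin n) (Fin n) ℂ} (hPQ : Commute P Q) {μ : ℂ}
    (hμ : μ ∈ spectrum ℂ P) :
    ∃ V : Matrix (Fin n) (Fin n) ℂ, V ≠ 0 ∧ P * V = μ • V ∧ ∃ q ∈ spectrum ℂ Q, Q * V = q • V := by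
  set f := Matrix.toLin' P with hf
  set g := Matrix.toLin' Q with hg
  have hfg : Commute f g := by
    rw [Commute, SemiconjBy, hf, hg, Module.End.mul_eq_comp, Module.End.mul_eq_comp,
      ← Matrix.toLin'_mul, ← Matrix.toLin'_mul, hPQ.eq]
  have hev : Module.End.HasEigenvalue f μ := by
    rw [Module.End.hasEigenvalue_iff_mem_spectrum, hf, Matrix.spectrum_toLin']
    exact hμ
  have hmaps : Set.MapsTo g (Module.End.eigenspace f μ) (Module.End.eigenspace f μ) :=
    Module.End.mapsTo_genEigenspace_of_comm hfg μ 1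
  have : Nontrivial (Module.End.eigenspace f μ) := Submodule.nontrivial_iff_ne_bot.mpr hev
  obtain ⟨q, hq⟩ := Module.End.exists_eigenvalue (g.restrict hmaps)
  obtain ⟨w, hw⟩ := hq.exists_hasEigenvector
  have hw0 : (w : Fin n → ℂ) ≠ 0 := fun h0 => hw.2 (Subtype.ext h0)
  have hgw : g w = q • (w : Fin n → ℂ) := by
    exact congrArg Subtype.val hw.apply_eq_smul
  have hfw : f w = μ • (w : Fin n → ℂ) := Module.End.mem_eigenspace_iff.mp w.2
  have hspec : q ∈ spectrum ℂ Q := by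
    rw [← Matrix.spectrum_toLin', ← Module.End.hasEigenvalue_iff_mem_spectrum]
    exact Module.End.hasEigenvalue_of_hasEigenvector
      (Module.End.hasEigenvector_iff.mpr ⟨Module.End.mem_eigenspace_iff.mpr hgw, hw0⟩)
  replace hfw : P.mulVec w = μ • (w : Fin n → ℂ) := hfw
  replace hgw : Q.mulVec w = q • (w : Fin n → ℂ) := hgw
  -- The rank-one matrix `w wᵀ` turns the common eigenvector `w` into an element of the algebra.
  refine ⟨Matrix.vecMulVec w w, ?_, ?_, q, hspec, ?_⟩
  · simpa [Matrix.vecMulVec_eq_zero] using hw0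
  · rw [Matrix.mul_vecMulVec, hfw, Matrix.smul_vecMulVec]
  · rw [Matrix.mul_vecMulVec, hgw, Matrix.smul_vecMulVec]

theorem eventually_isUnit_add_smul_one (M : Matrix (Fin n) (Fin n) ℂ) :
    ∀ᶠ z in 𝓝[≠] (0 : ℂ), IsUnit (M + z • (1 : Matrix (Fin n) (Fin n) ℂ)) := by
  have hfin : (spectrum ℂ (-M)).Finite := by
    rw [← Matrix.spectrum_toLin']
    exact Module.End.finite_spectrum _
  filter_upwards [nhdsNE_le_cofinite 0 hfin.compl_mem_cofinite] with z hz
  have hz' := spectrum.notMem_iff.mp hz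
  rwa [sub_neg_eq_add, Algebra.algebraMap_eq_smul_one, add_comm] at hz'

-- Existence and uniqueness of the principal logarithm.

attribute [local instance] Matrix.linftyOpNormedRing Matrix.linftyOpNormedAlgebra

/-- For real `t ≤ 0`, `t - (1 + C) = (t - 1)(1 + sC)` with `s = 1 / (1 - t)` in `(0, 1]`, which is a
unit. -/
theorem SegmentUnits.one_add_mem_slitPlane {C : Matrix (Fin n) (Fin n) ℂ} (h : SegmentUnits C)
    {μ : ℂ} (hμ : μ ∈ spectrum ℂ (1 + C)) : μ ∈ Complex.slitPlane := by
  by_contra hslit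
  rw [Complex.mem_slitPlane_iff] at hslit
  push Not at hslit
  obtain ⟨t, rfl⟩ : ∃ t : ℝ, μ = (t : ℂ) := ⟨μ.re, Complex.ext rfl hslit.2⟩
  have ht : t ≤ 0 := hslit.1
  have h1 : (0 : ℝ) < 1 - t := by linarith
  have hu := h (1 - t)⁻¹ ⟨by positivity, inv_le_one_of_one_le₀ (by linarith)⟩
  refine hμ ?_
  change IsUnit (algebraMap ℂ (Matrix (Fin n) (Fin n) ℂ) t - (1 + C))
  have hne : ((t : ℂ) - 1) ≠ 0 := by
    exact_mod_cast (by linarith : t - 1 ≠ 0)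
  have hne' : ((1 : ℂ) - t) ≠ 0 := by
    exact_mod_cast h1.ne'
  have key : algebraMap ℂ (Matrix (Fin n) (Fin n) ℂ) t - (1 + C) =
      (Units.mk0 ((t : ℂ) - 1) hne) • (1 + (((1 - t)⁻¹ : ℝ) : ℂ) • C) := by
    rw [Units.smul_mk0, Algebra.algebraMap_eq_smul_one, smul_add, smul_smul]
    have : ((t : ℂ) - 1) * (((1 - t)⁻¹ : ℝ) : ℂ) = -1 := by
      rw [Complex.ofReal_inv, Complex.ofReal_sub, Complex.ofReal_one, ← neg_sub (1 : ℂ), neg_mul,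
        mul_inv_cancel₀ hne']
    rw [this, sub_smul]
    simp
    abel
  rw [key]
  exact hu.smul _

theorem one_add_mem_spectrum {C : Matrix (Fin n) (Fin n) ℂ} {c : ℂ} (h : c ∈ spectrum ℂ C) :
    1 + c ∈ spectrum ℂ (1 + C) := by
  have := (spectrum.add_mem_add_iff (a := C) (r := c) (s := 1)).mpr h
  simpa [add_comm] using this

/-- On a common eigenvector of `C * D` and `C`, the eigenvalue of `C * D` is the scalar `log (1 +
c)`, whose imaginary part is an argument off the branch cut. -/
theorem SegmentUnits.isPrincipalLog {C : Matrix (Fin n) (Fin n) ℂ} (h : SegmentUnits C) :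
    IsPrincipalLog (1 + C) (C * resolventMean C) := by
  refine ⟨h.exp_mul_resolventMean, fun μ hμ => ?_⟩
  have hcom : Commute (C * resolventMean C) C :=
    ((Commute.refl C).mul_right (h.commute_resolventMean (Commute.refl C))).symm
  obtain ⟨V, hV, hμV, c, hc, hcV⟩ := exists_common_eigenvector hcom hμ
  have hslit := h.one_add_mem_slitPlane (one_add_mem_spectrum hc)
  have hlog := h.log_mul hcV hslit
  rw [hμV] at hlog
  have : μ = Complex.log (1 + c) := smul_left_injective ℂ hV hlog
  rw [this, Complex.log_im]
  exact ⟨Complex.neg_pi_lt_arg _, lt_of_le_of_ne (Complex.arg_le_pi _)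
    (Complex.mem_slitPlane_iff_arg.mp hslit).1⟩

/-- Here `N ψ₁(N) = 0`, and `ψ₁(N)` is invertible: otherwise some common eigenvector is killed by
both `ψ₁(N)` and `N`, but `ψ₁(N)` fixes whatever `N` kills. -/
theorem eq_zero_of_exp_eq_one {N : Matrix (Fin n) (Fin n) ℂ} (hN : spectrum ℂ N ⊆ {0})
    (h : NormedSpace.exp N = 1) : N = 0 := by
  have hmul : N * expQuotient N = 0 := (mul_expQuotient N).trans (sub_eq_zero.mpr h)
  have hcom : Commute (expQuotient N) N := by
    have hs := summable_expQuotient N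
    rw [Commute, SemiconjBy, expQuotient, ← hs.tsum_mul_left, ← hs.tsum_mul_right]
    exact tsum_congr fun j => by rw [smul_mul_assoc, mul_smul_comm, ← pow_succ, ← pow_succ']
  suffices IsUnit (expQuotient N) from this.mul_left_eq_zero.mp hmul
  by_contra hu
  obtain ⟨V, hV, h0, q, hq, hqV⟩ := exists_common_eigenvector hcom
    (spectrum.zero_mem ℂ hu)
  rw [Set.mem_singleton_iff.mp (hN hq), zero_smul] at hqV
  rw [expQuotient_apply_of_mul_eq_zero hqV, zero_smul] at h0
  exact hV h0

/-- `Q` commutes with `exp Q = 1 + C`, hence with `Y = C * D`. On common eigenvectors the two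
eigenvalues have equal exponentials and lie in the strip, so they agree; thus `Q - Y` has spectrum
in `{0}` and exponential `1`. -/
theorem SegmentUnits.eq_of_isPrincipalLog {C Q : Matrix (Fin n) (Fin n) ℂ} (h : SegmentUnits C)
    (hQ : IsPrincipalLog (1 + C) Q) : Q = C * resolventMean C := by
  let : NormedAlgebra ℚ (Matrix (Fin n) (Fin n) ℂ) := NormedAlgebra.restrictScalars ℚ ℂ _
  set Y := C * resolventMean C
  have hYlog := h.isPrincipalLog
  have hexp : NormedSpace.exp Q = NormedSpace.exp Y := hQ.1.trans hYlog.1.symm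
  have hQC : Commute Q C := by
    have h1 : Commute Q (NormedSpace.exp Q) := (Commute.refl Q).exp_right
    rw [hQ.1] at h1
    simpa using h1.sub_right (Commute.one_right Q)
  have hQY : Commute Q Y := hQC.mul_right (h.commute_resolventMean hQC)
  rw [← sub_eq_zero]
  refine eq_zero_of_exp_eq_one (fun ν hν => ?_) ?_
  · have hNQ : Commute (Q - Y) Q := (Commute.refl Q).sub_left hQY.symm
    obtain ⟨V, hV, hνV, q, hq, hqV⟩ := exists_common_eigenvector hNQ hν
    have hyV : Y * V = (q - ν) • V := by
      rw [sub_smul, ← hqV, ← hνV, sub_mul]; abel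
    have hy : q - ν ∈ spectrum ℂ Y := fun hu => hV <| by
      refine hu.mul_right_eq_zero.mp ?_
      rw [sub_mul, Algebra.algebraMap_eq_smul_one, smul_mul_assoc, one_mul, hyV, sub_self]
    have he := exp_eigenvalue_eq hexp hV hqV hyV
    have hq' := hQ.2 q hq
    have hy' := hYlog.2 _ hy
    have := Complex.exp_inj_of_neg_pi_lt_of_le_pi hq'.1 hq'.2.le hy'.1 hy'.2.le he
    exact sub_eq_self.mp this.symm
  · exact exp_sub_eq_one hQY hexp

theorem SegmentUnits.hasPrincipalLog {C : Matrix (Fin n) (Fin n) ℂ} (h : SegmentUnits C) :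
    HasPrincipalLog (1 + C) :=
  ⟨fun _ hμ => h.one_add_mem_slitPlane hμ, _, h.isPrincipalLog, fun _ hQ =>
    h.eq_of_isPrincipalLog hQ⟩

theorem SegmentUnits.principalLog_eq {C : Matrix (Fin n) (Fin n) ℂ} (h : SegmentUnits C) :
    principalLog (1 + C) = C * resolventMean C :=
  h.eq_of_isPrincipalLog h.hasPrincipalLog.isPrincipalLog

theorem SegmentUnits.resolventMean_mul_psi1 {C : Matrix (Fin n) (Fin n) ℂ} (h : SegmentUnits C) :
    resolventMean C * psi1 (C * resolventMean C) = 1 :=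
  h.resolventMean_mul_expQuotient (eventually_isUnit_add_smul_one C)

end Matrices

/-! ### The pencil: invertibility and the affine path `Ω`. -/

section Pencil

open Filter

variable {n : ℕ}

theorem Omega_zero (A E : Matrix (Fin n) (Fin n) ℂ) (α β : ℂ) (ω : ℝ) :
    Omega A E α β ω 0 = (ω : ℂ) • E + Complex.I • A := by
  simp [Omega, Eeps, Aeps]

theorem smul_Omega_zero (A E : Matrix (Fin n) (Fin n) ℂ) (α β : ℂ) (ω : ℝ) :
    Complex.I • Omega A E α β ω 0 = (Complex.I * (ω : ℂ)) • E - A := by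
  rw [Omega_zero, smul_add, smul_smul, smul_smul, Complex.I_mul_I, neg_one_smul, sub_eq_add_neg]

theorem isUnit_Omega_zero {A E : Matrix (Fin n) (Fin n) ℂ} (α β : ℂ) {ω : ℝ}
    (h : Complex.I * (ω : ℂ) ∉ eigenvalues A E) : IsUnit (Omega A E α β ω 0) := by
  have h1 : IsUnit (A - (Complex.I * (ω : ℂ)) • E) :=
    (Matrix.isUnit_iff_isUnit_det _).mpr (isUnit_iff_ne_zero.mpr h)
  have h2 : Omega A E α β ω 0 =
      Units.mk0 Complex.I Complex.I_ne_zero • (A - (Complex.I * (ω : ℂ)) • E) := by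
    rw [Units.smul_mk0, ← neg_sub, ← smul_Omega_zero A E α β, smul_neg, smul_smul,
      Complex.I_mul_I, neg_one_smul, neg_neg]
  rw [h2]
  exact h1.smul _

theorem K_eq_smul_inv_Omega {A E : Matrix (Fin n) (Fin n) ℂ} {α β : ℂ} {ω : ℝ}
    (h : IsUnit (Omega A E α β ω 0)) :
    K A E (Complex.I * (ω : ℂ)) = (1 / Complex.I) • (Omega A E α β ω 0)⁻¹ := by
  rw [K, ← smul_Omega_zero A E α β]
  refine Matrix.inv_eq_right_inv ?_
  rw [Matrix.smul_mul, Matrix.mul_smul, smul_smul, mul_one_div_cancel Complex.I_ne_zero,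
    Matrix.mul_nonsing_inv _ ((Matrix.isUnit_iff_isUnit_det _).mp h), one_smul]

theorem Omega_add (A E : Matrix (Fin n) (Fin n) ℂ) (α β : ℂ) (ω t : ℝ) (ε : ℂ) :
    Omega A E α β (ω + t) ε = Omega A E α β ω ε + (t : ℂ) • Eeps E β ε := by
  rw [Omega, Omega, Complex.ofReal_add, add_smul]
  abel

theorem continuous_Omega (A E : Matrix (Fin n) (Fin n) ℂ) (α β : ℂ) :
    Continuous fun p : ℂ × ℝ => Omega A E α β p.2 p.1 := by
  unfold Omega Eeps Aeps
  fun_prop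

theorem eventually_isUnit_Omega {A E : Matrix (Fin n) (Fin n) ℂ} {α β : ℂ} {ω₁ ω₂ : ℝ}
    (h : ∀ ω ∈ Set.uIcc ω₁ ω₂, IsUnit (Omega A E α β ω 0)) :
    ∀ᶠ ε in 𝓝 (0 : ℂ), ∀ ω ∈ Set.uIcc ω₁ ω₂, IsUnit (Omega A E α β ω ε) := by
  refine isCompact_uIcc.eventually_forall_of_forall_eventually fun ω hω => ?_
  simp only [Matrix.isUnit_iff_isUnit_det, isUnit_iff_ne_zero] at h ⊢
  exact ((continuous_Omega A E α β).matrix_det.continuousAt (x := ((0 : ℂ), ω))).eventually_ne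
    (h ω hω)

/-- If `β = 0`, then `W = αE` makes `E` itself invertible; otherwise `βε` avoids the finitely many
eigenvalues of `E` for small `ε ≠ 0`. -/
theorem eventually_isUnit_Eeps {A E : Matrix (Fin n) (Fin n) ℂ} {α β : ℂ}
    (hW : IsUnit (W A E α β)) : ∀ᶠ ε in 𝓝[≠] (0 : ℂ), IsUnit (Eeps E β ε) := by
  by_cases hβ : β = 0
  · subst hβ
    refine Eventually.of_forall fun ε => ?_
    rw [W, zero_smul, add_zero] at hW
    rw [Eeps, zero_mul, zero_smul, sub_zero]
    rw [Matrix.isUnit_iff_isUnit_det, Matrix.det_smul] at hW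
    exact (Matrix.isUnit_iff_isUnit_det _).mpr (isUnit_of_mul_isUnit_right hW)
  · have ht : Tendsto (fun ε : ℂ => -(β * ε)) (𝓝[≠] 0) (𝓝[≠] 0) := by
      refine tendsto_nhdsWithin_iff.mpr ⟨?_, ?_⟩
      · have : ContinuousAt (fun ε : ℂ => -(β * ε)) 0 := by fun_prop
        simpa [ContinuousAt] using this.tendsto.mono_left nhdsWithin_le_nhds
      · filter_upwards [self_mem_nhdsWithin] with ε hε
        simpa [hβ] using hε
    filter_upwards [ht.eventually (eventually_isUnit_add_smul_one E)] with ε hε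
    rwa [neg_smul, ← sub_eq_add_neg] at hε

/-- The matrix `C` with `Ω(ω₂, ε) Ω(ω₁, ε)⁻¹ = 1 + C`. -/
noncomputable def increment (A E : Matrix (Fin n) (Fin n) ℂ) (α β : ℂ) (ω₁ ω₂ : ℝ) (ε : ℂ) :
    Matrix (Fin n) (Fin n) ℂ :=
  ((ω₂ - ω₁ : ℝ) : ℂ) • (Eeps E β ε * (Omega A E α β ω₁ ε)⁻¹)

theorem one_add_smul_increment {A E : Matrix (Fin n) (Fin n) ℂ} {α β : ℂ} {ω₁ ω₂ : ℝ} {ε : ℂ}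
    (h : IsUnit (Omega A E α β ω₁ ε)) (s : ℝ) :
    1 + (s : ℂ) • increment A E α β ω₁ ω₂ ε =
      Omega A E α β (ω₁ + (ω₂ - ω₁) * s) ε * (Omega A E α β ω₁ ε)⁻¹ := by
  rw [Omega_add, add_mul, Matrix.mul_nonsing_inv _ ((Matrix.isUnit_iff_isUnit_det _).mp h),
    increment, smul_smul, Matrix.smul_mul, Complex.ofReal_mul, mul_comm (s : ℂ)]

theorem one_add_increment {A E : Matrix (Fin n) (Fin n) ℂ} {α β : ℂ} {ω₁ ω₂ : ℝ} {ε : ℂ}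
    (h : IsUnit (Omega A E α β ω₁ ε)) :
    Omega A E α β ω₂ ε * (Omega A E α β ω₁ ε)⁻¹ = 1 + increment A E α β ω₁ ω₂ ε := by
  have := one_add_smul_increment (ω₂ := ω₂) h 1
  rw [Complex.ofReal_one, one_smul, mul_one, add_sub_cancel] at this
  exact this.symm

theorem add_mul_mem_uIcc (a b : ℝ) {s : ℝ} (hs : s ∈ Set.Icc (0 : ℝ) 1) :
    a + (b - a) * s ∈ Set.uIcc a b := by
  rw [← segment_eq_uIcc, segment_eq_image']
  exact ⟨s, hs, by simp [mul_comm]⟩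

theorem continuousAt_inv_Omega {A E : Matrix (Fin n) (Fin n) ℂ} {α β : ℂ} {ω : ℝ} {ε : ℂ}
    (h : IsUnit (Omega A E α β ω ε)) :
    ContinuousAt (fun p : ℂ × ℝ => (Omega A E α β p.2 p.1)⁻¹) (ε, ω) := by
  have hdet := (Matrix.isUnit_iff_isUnit_det _).mp h
  simp only [Matrix.inv_def, Ring.inverse_eq_inv']
  exact ((continuous_Omega A E α β).matrix_det.continuousAt.inv₀ hdet.ne_zero).smul
    (continuous_Omega A E α β).matrix_adjugate.continuousAt

theorem continuousAt_increment {A E : Matrix (Fin n) (Fin n) ℂ} {α β : ℂ} {ω₁ : ℝ} (ω₂ : ℝ)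
    {ε : ℂ} (h : IsUnit (Omega A E α β ω₁ ε)) :
    ContinuousAt (increment A E α β ω₁ ω₂) ε := by
  have h1 : ContinuousAt (fun ε : ℂ => (Omega A E α β ω₁ ε)⁻¹) ε :=
    ContinuousAt.comp (f := fun ε : ℂ => (ε, ω₁)) (continuousAt_inv_Omega h) (by fun_prop)
  have h2 : ContinuousAt (Eeps E β) ε := by unfold Eeps; fun_prop
  exact (h2.mul h1).const_smul ((ω₂ - ω₁ : ℝ) : ℂ)

theorem intervalIntegrable_K {A E : Matrix (Fin n) (Fin n) ℂ} {α β : ℂ} {ω₁ ω₂ : ℝ}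
    (h : ∀ ω ∈ Set.uIcc ω₁ ω₂, IsUnit (Omega A E α β ω 0)) (i k : Fin n) :
    IntervalIntegrable (fun ω : ℝ => K A E (Complex.I * (ω : ℂ)) i k)
      MeasureTheory.volume ω₁ ω₂ := by
  have hc : ContinuousOn (fun ω : ℝ => (1 / Complex.I) • (Omega A E α β ω 0)⁻¹)
      (Set.uIcc ω₁ ω₂) := 
    ContinuousOn.const_smul (fun ω hω =>
      (ContinuousAt.comp (f := fun ω : ℝ => ((0 : ℂ), ω)) (continuousAt_inv_Omega (h ω hω))
        (by fun_prop)).continuousWithinAt) (1 / Complex.I)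
  have hK : ContinuousOn (fun ω : ℝ => K A E (Complex.I * (ω : ℂ))) (Set.uIcc ω₁ ω₂) :=
    hc.congr fun ω hω => K_eq_smul_inv_Omega (h ω hω)
  exact ((continuous_apply_apply i k).comp_continuousOn hK).intervalIntegrable

-- The integral and the logarithms in terms of `resolventMean`.

attribute [local instance] Matrix.linftyOpNormedRing Matrix.linftyOpNormedAlgebra

theorem segmentUnits_increment {A E : Matrix (Fin n) (Fin n) ℂ} {α β : ℂ} {ω₁ ω₂ : ℝ} {ε : ℂ}
    (h : ∀ ω ∈ Set.uIcc ω₁ ω₂, IsUnit (Omega A E α β ω ε)) :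
    SegmentUnits (increment A E α β ω₁ ω₂ ε) := fun s hs => by
  have h1 := h ω₁ Set.left_mem_uIcc
  have h2 := one_add_smul_increment (ω₂ := ω₂) h1 s
  refine h2 ▸ (h _ (add_mul_mem_uIcc ω₁ ω₂ hs)).mul ?_
  exact Matrix.isUnit_nonsing_inv_iff.mpr h1

/-- The integral `∫ Ω(ω, ε)⁻¹ dω` from `ω₁` to `ω₂`. -/
noncomputable def omegaIntegral (A E : Matrix (Fin n) (Fin n) ℂ) (α β : ℂ) (ω₁ ω₂ : ℝ) (ε : ℂ) :
    Matrix (Fin n) (Fin n) ℂ :=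
  ((ω₂ - ω₁ : ℝ) : ℂ) • ((Omega A E α β ω₁ ε)⁻¹ * resolventMean (increment A E α β ω₁ ω₂ ε))

theorem tendsto_resolventMean_increment {A E : Matrix (Fin n) (Fin n) ℂ} {α β : ℂ} {ω₁ ω₂ : ℝ}
    (h : ∀ ω ∈ Set.uIcc ω₁ ω₂, IsUnit (Omega A E α β ω 0)) :
    Tendsto (fun ε => resolventMean (increment A E α β ω₁ ω₂ ε)) (𝓝[≠] 0)
      (𝓝 (resolventMean (increment A E α β ω₁ ω₂ 0))) :=
  ((segmentUnits_increment h).continuousAt_resolventMean.tendsto.comp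
    (continuousAt_increment ω₂ (h ω₁ Set.left_mem_uIcc)).tendsto).mono_left nhdsWithin_le_nhds

/-- No `E_ε⁻¹` occurs in this expression, so a singular `E` is harmless. -/
theorem tendsto_omegaIntegral {A E : Matrix (Fin n) (Fin n) ℂ} {α β : ℂ} {ω₁ ω₂ : ℝ}
    (h : ∀ ω ∈ Set.uIcc ω₁ ω₂, IsUnit (Omega A E α β ω 0)) :
    Tendsto (omegaIntegral A E α β ω₁ ω₂) (𝓝[≠] 0) (𝓝 (omegaIntegral A E α β ω₁ ω₂ 0)) := by
  have h1 : ContinuousAt (fun ε : ℂ => (Omega A E α β ω₁ ε)⁻¹) 0 :=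
    ContinuousAt.comp (f := fun ε : ℂ => (ε, ω₁))
      (continuousAt_inv_Omega (h ω₁ Set.left_mem_uIcc)) (by fun_prop)
  exact ((h1.tendsto.mono_left nhdsWithin_le_nhds).mul
    (tendsto_resolventMean_increment h)).const_smul _

/-- Substitute `ω = ω₁ + (ω₂ - ω₁)s` and use `Ω(ω)⁻¹ = Ω(ω₁)⁻¹ (1 + sC)⁻¹`. -/
theorem matrixIntegral_K {A E : Matrix (Fin n) (Fin n) ℂ} {α β : ℂ} {ω₁ ω₂ : ℝ}
    (h : ∀ ω ∈ Set.uIcc ω₁ ω₂, IsUnit (Omega A E α β ω 0)) :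
    matrixIntegral (fun ω : ℝ => K A E (Complex.I * (ω : ℂ))) ω₁ ω₂ =
      (1 / Complex.I) • omegaIntegral A E α β ω₁ ω₂ 0 := by
  have hC := segmentUnits_increment h
  have h1 := h ω₁ Set.left_mem_uIcc
  have hdet1 := (Matrix.isUnit_iff_isUnit_det _).mp h1
  ext i k
  rw [matrixIntegral, Matrix.of_apply]
  -- This functional passes from the matrix-valued integral in `resolventMean` to the entrywise one.
  set Λ : Matrix (Fin n) (Fin n) ℂ →ₗ[ℝ] ℂ :=
    { toFun := fun M => ((1 / Complex.I) • ((Omega A E α β ω₁ 0)⁻¹ * M)) i k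
      map_add' := fun M N => by rw [mul_add, smul_add, Matrix.add_apply]
      map_smul' := fun r M => by
        rw [Matrix.mul_smul, smul_comm, Matrix.smul_apply, RingHom.id_apply] }
  have hint := (LinearMap.toContinuousLinearMap Λ).intervalIntegral_comp_comm hC.intervalIntegrable
  have hsub := intervalIntegral.smul_integral_comp_add_mul (a := 0) (b := 1)
    (fun ω : ℝ => K A E (Complex.I * (ω : ℂ)) i k) (ω₂ - ω₁) ω₁
  rw [mul_zero, add_zero, mul_one, add_sub_cancel] at hsub
  rw [← hsub]
  have hcongr : ∫ s in (0 : ℝ)..1, K A E (Complex.I * ((ω₁ + (ω₂ - ω₁) * s : ℝ) : ℂ)) i k =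
      ∫ s in (0 : ℝ)..1, (LinearMap.toContinuousLinearMap Λ)
        (Ring.inverse (1 + (s : ℂ) • increment A E α β ω₁ ω₂ 0)) := by
    refine intervalIntegral.integral_congr fun s hs => ?_
    rw [Set.uIcc_of_le zero_le_one] at hs
    have hs' := h _ (add_mul_mem_uIcc ω₁ ω₂ hs)
    change K A E (Complex.I * ((ω₁ + (ω₂ - ω₁) * s : ℝ) : ℂ)) i k = ((1 / Complex.I) •
      ((Omega A E α β ω₁ 0)⁻¹ * Ring.inverse (1 + (s : ℂ) • increment A E α β ω₁ ω₂ 0))) i k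
    rw [one_add_smul_increment h1, ← Matrix.nonsing_inv_eq_ringInverse, Matrix.mul_inv_rev,
      Matrix.nonsing_inv_nonsing_inv _ hdet1, Matrix.nonsing_inv_mul_cancel_left _ _ hdet1]
    rw [K_eq_smul_inv_Omega hs']
  refine (congrArg ((ω₂ - ω₁) • ·) (hcongr.trans hint)).trans ?_
  change (ω₂ - ω₁) • ((1 / Complex.I) • ((Omega A E α β ω₁ 0)⁻¹ *
    resolventMean (increment A E α β ω₁ ω₂ 0))) i k = _
  rw [omegaIntegral, smul_comm, Matrix.smul_apply, Complex.real_smul, smul_eq_mul]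
  rfl

theorem hasPrincipalLog_mul_inv {A E : Matrix (Fin n) (Fin n) ℂ} {α β : ℂ} {ω₁ ω₂ : ℝ} {ε : ℂ}
    (h : ∀ ω ∈ Set.uIcc ω₁ ω₂, IsUnit (Omega A E α β ω ε)) :
    HasPrincipalLog (Omega A E α β ω₂ ε * (Omega A E α β ω₁ ε)⁻¹) := by
  rw [one_add_increment (h ω₁ Set.left_mem_uIcc)]
  exact (segmentUnits_increment h).hasPrincipalLog

theorem Yeps_eq {A E : Matrix (Fin n) (Fin n) ℂ} {α β : ℂ} {ω₁ ω₂ : ℝ} {ε : ℂ}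
    (h : ∀ ω ∈ Set.uIcc ω₁ ω₂, IsUnit (Omega A E α β ω ε)) :
    Yeps A E α β ω₁ ω₂ ε =
      increment A E α β ω₁ ω₂ ε * resolventMean (increment A E α β ω₁ ω₂ ε) := by
  rw [Yeps, one_add_increment (h ω₁ Set.left_mem_uIcc)]
  exact (segmentUnits_increment h).principalLog_eq

theorem principalLog_mul_inv {A E : Matrix (Fin n) (Fin n) ℂ} {α β : ℂ} {ω₁ ω₂ : ℝ} {ε : ℂ}
    (h : ∀ ω ∈ Set.uIcc ω₁ ω₂, IsUnit (Omega A E α β ω ε)) :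
    principalLog (Omega A E α β ω₂ ε * (Omega A E α β ω₁ ε)⁻¹) =
      Eeps E β ε * omegaIntegral A E α β ω₁ ω₂ ε := by
  refine (Yeps_eq h).trans ?_
  rw [omegaIntegral, Matrix.mul_smul, ← mul_assoc, ← Matrix.smul_mul]
  rfl

theorem inv_mul_eq_conj {A E : Matrix (Fin n) (Fin n) ℂ} {α β : ℂ} {ω₁ ω₂ : ℝ} {ε : ℂ}
    (u : (Matrix (Fin n) (Fin n) ℂ)ˣ) (hu : (u : Matrix (Fin n) (Fin n) ℂ) = Omega A E α β ω₁ ε) :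
    (Omega A E α β ω₁ ε)⁻¹ * Omega A E α β ω₂ ε =
      1 + u⁻¹.val * increment A E α β ω₁ ω₂ ε * u.val := by
  have h1 : IsUnit (Omega A E α β ω₁ ε) := ⟨u, hu⟩
  have h2 := one_add_smul_conj u (increment A E α β ω₁ ω₂ ε) 1
  rw [one_smul, one_smul, ← one_add_increment h1, Matrix.coe_units_inv, hu, mul_assoc _⁻¹ (_ * _),
    mul_assoc (Omega A E α β ω₂ ε), Matrix.nonsing_inv_mul _ ((Matrix.isUnit_iff_isUnit_det _).mp h1), mul_one] at h2
  rw [Matrix.coe_units_inv, hu]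
  exact h2.symm

theorem hasPrincipalLog_inv_mul {A E : Matrix (Fin n) (Fin n) ℂ} {α β : ℂ} {ω₁ ω₂ : ℝ} {ε : ℂ}
    (h : ∀ ω ∈ Set.uIcc ω₁ ω₂, IsUnit (Omega A E α β ω ε)) :
    HasPrincipalLog ((Omega A E α β ω₁ ε)⁻¹ * Omega A E α β ω₂ ε) := by
  obtain ⟨u, hu⟩ := h ω₁ Set.left_mem_uIcc
  rw [inv_mul_eq_conj u hu]
  exact ((segmentUnits_increment h).conj u).hasPrincipalLog

/-- Conjugation by `Ω(ω₁)` gives `Ω(ω₁)⁻¹ C D Ω(ω₁)`. As `C` and `D` commute, `C` can stand last,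
where `C Ω(ω₁) = (ω₂ - ω₁) E_ε`. -/
theorem principalLog_inv_mul {A E : Matrix (Fin n) (Fin n) ℂ} {α β : ℂ} {ω₁ ω₂ : ℝ} {ε : ℂ}
    (h : ∀ ω ∈ Set.uIcc ω₁ ω₂, IsUnit (Omega A E α β ω ε)) :
    principalLog ((Omega A E α β ω₁ ε)⁻¹ * Omega A E α β ω₂ ε) =
      omegaIntegral A E α β ω₁ ω₂ ε * Eeps E β ε := by
  have hC := segmentUnits_increment h
  obtain ⟨u, hu⟩ := h ω₁ Set.left_mem_uIcc
  have hdet : IsUnit (Omega A E α β ω₁ ε).det := (Matrix.isUnit_iff_isUnit_det _).mp ⟨u, hu⟩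
  rw [inv_mul_eq_conj u hu, (hC.conj u).principalLog_eq, hC.resolventMean_conj u]
  have h1 : (u⁻¹.val * increment A E α β ω₁ ω₂ ε * u.val) *
      (u⁻¹.val * resolventMean (increment A E α β ω₁ ω₂ ε) * u.val) =
      u⁻¹.val * (increment A E α β ω₁ ω₂ ε * resolventMean (increment A E α β ω₁ ω₂ ε)) * u.val := by
    simp only [mul_assoc, Units.mul_inv_cancel_left]
  rw [h1, (hC.commute_resolventMean (Commute.refl _)).eq, omegaIntegral, Matrix.coe_units_inv, hu]
  set D := resolventMean (increment A E α β ω₁ ω₂ ε)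
  rw [increment]
  simp only [Matrix.mul_smul, Matrix.smul_mul, mul_assoc]
  rw [Matrix.nonsing_inv_mul _ hdet, mul_one]

theorem exp_Yeps {A E : Matrix (Fin n) (Fin n) ℂ} {α β : ℂ} {ω₁ ω₂ : ℝ} {ε : ℂ}
    (h : ∀ ω ∈ Set.uIcc ω₁ ω₂, IsUnit (Omega A E α β ω ε)) :
    NormedSpace.exp (Yeps A E α β ω₁ ω₂ ε) = 1 + increment A E α β ω₁ ω₂ ε := by
  have := (hasPrincipalLog_mul_inv h).isPrincipalLog.1
  rwa [← one_add_increment (h ω₁ Set.left_mem_uIcc)]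

theorem resolventMean_mul_psi1_Ylim {A E : Matrix (Fin n) (Fin n) ℂ} {α β : ℂ} {ω₁ ω₂ : ℝ}
    (h : ∀ ω ∈ Set.uIcc ω₁ ω₂, IsUnit (Omega A E α β ω 0)) :
    resolventMean (increment A E α β ω₁ ω₂ 0) * psi1 (Ylim A E α β ω₁ ω₂) = 1 := by
  rw [Ylim, Yeps_eq h]
  exact (segmentUnits_increment h).resolventMean_mul_psi1

theorem L_eq_resolventMean {A E : Matrix (Fin n) (Fin n) ℂ} {α β : ℂ} {ω₁ ω₂ : ℝ}
    (h : ∀ ω ∈ Set.uIcc ω₁ ω₂, IsUnit (Omega A E α β ω 0)) :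
    L A E α β ω₁ ω₂ = resolventMean (increment A E α β ω₁ ω₂ 0) :=
  Matrix.inv_eq_left_inv (resolventMean_mul_psi1_Ylim h)

theorem isUnit_increment {A E : Matrix (Fin n) (Fin n) ℂ} {α β : ℂ} {ω₁ ω₂ : ℝ} {ε : ℂ}
    (hne : ω₁ ≠ ω₂) (hE : IsUnit (Eeps E β ε)) (h1 : IsUnit (Omega A E α β ω₁ ε)) :
    IsUnit (increment A E α β ω₁ ω₂ ε) := by
  have hc : ((ω₂ - ω₁ : ℝ) : ℂ) ≠ 0 := Complex.ofReal_ne_zero.mpr (sub_ne_zero.mpr hne.symm)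
  exact (hE.mul (Matrix.isUnit_nonsing_inv_iff.mpr h1)).smul (Units.mk0 _ hc)

/-- For small `ε ≠ 0` the expression is `C⁻¹ (C D) = D`; `ω₁ ≠ ω₂` and the invertibility of `E_ε`
make `C` invertible. -/
theorem tendsto_inv_exp_sub_one_mul {A E : Matrix (Fin n) (Fin n) ℂ} {α β : ℂ} {ω₁ ω₂ : ℝ}
    (hW : IsUnit (W A E α β)) (h : ∀ ω ∈ Set.uIcc ω₁ ω₂, IsUnit (Omega A E α β ω 0))
    (hne : ω₁ ≠ ω₂) :
    Tendsto (fun ε : ℂ => (NormedSpace.exp (Yeps A E α β ω₁ ω₂ ε) - 1)⁻¹ *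
      Yeps A E α β ω₁ ω₂ ε) (𝓝[≠] 0) (𝓝 (L A E α β ω₁ ω₂)) := by
  rw [L_eq_resolventMean h]
  refine (tendsto_resolventMean_increment h).congr' ?_
  filter_upwards [eventually_isUnit_Eeps hW,
    nhdsWithin_le_nhds (eventually_isUnit_Omega h)] with ε hE hε
  have hC := isUnit_increment hne hE (hε ω₁ Set.left_mem_uIcc)
  have hexp : NormedSpace.exp (Yeps A E α β ω₁ ω₂ ε) - 1 = increment A E α β ω₁ ω₂ ε :=
    sub_eq_iff_eq_add'.mpr (exp_Yeps hε)
  have hY := Yeps_eq hε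
  refine Eq.trans ?_ (congrArg₂ (fun M N => M⁻¹ * N) hexp hY).symm
  exact (Matrix.nonsing_inv_mul_cancel_left _ _ ((Matrix.isUnit_iff_isUnit_det _).mp hC)).symm

/-- With `c = ω₂ - ω₁`, the two terms are `cj β A Ω₁⁻¹ D` and `cj α E Ω₁⁻¹ D`. They add up to `cj W
Ω₁⁻¹ D`, and `W` cancels; finally `-j = 1/j`. -/
theorem matrixIntegral_K_eq {A E : Matrix (Fin n) (Fin n) ℂ} {α β : ℂ} {ω₁ ω₂ : ℝ}
    (hW : IsUnit (W A E α β)) (h : ∀ ω ∈ Set.uIcc ω₁ ω₂, IsUnit (Omega A E α β ω 0)) :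
    matrixIntegral (fun ω : ℝ => K A E (Complex.I * (ω : ℂ))) ω₁ ω₂ =
      -((W A E α β)⁻¹ * (β • (L A E α β ω₁ ω₂ *
            ((ω₂ : ℂ) • (1 : Matrix (Fin n) (Fin n) ℂ) -
              (ω₁ : ℂ) • NormedSpace.exp (Ylim A E α β ω₁ ω₂))) +
          (Complex.I * α) • Ylim A E α β ω₁ ω₂)) := by
  have h1 := h ω₁ Set.left_mem_uIcc
  have hdet1 := (Matrix.isUnit_iff_isUnit_det _).mp h1
  have hCu := segmentUnits_increment h
  have hexp : NormedSpace.exp (Ylim A E α β ω₁ ω₂) = 1 + increment A E α β ω₁ ω₂ 0 :=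
    exp_Yeps h
  have hY : Ylim A E α β ω₁ ω₂ = _ := Yeps_eq h
  rw [matrixIntegral_K h, L_eq_resolventMean h, hexp, hY, omegaIntegral]
  set D := resolventMean (increment A E α β ω₁ ω₂ 0)
  set c : ℂ := ((ω₂ - ω₁ : ℝ) : ℂ) with hc
  set Ω₁ := Omega A E α β ω₁ 0 with hΩ
  have hCdef : increment A E α β ω₁ ω₂ 0 = c • (E * Ω₁⁻¹) := by
    rw [increment, Eeps, mul_zero, zero_smul, sub_zero]
  have hDC : Commute (increment A E α β ω₁ ω₂ 0) D := hCu.commute_resolventMean (Commute.refl _)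
  have hlin : (ω₂ : ℂ) • (1 : Matrix (Fin n) (Fin n) ℂ) -
      (ω₁ : ℂ) • (1 + increment A E α β ω₁ ω₂ 0) = (c * Complex.I) • (A * Ω₁⁻¹) := by
    have hA : Complex.I • A = Ω₁ - (ω₁ : ℂ) • E := by rw [hΩ, Omega_zero]; abel
    rw [mul_smul, ← Matrix.smul_mul, hA, sub_mul, Matrix.mul_nonsing_inv _ hdet1, hCdef,
      Matrix.smul_mul, hc, Complex.ofReal_sub]
    module
  -- `D` moves to the right because the other factor is affine in `C`.
  have hcomm : D * ((ω₂ : ℂ) • (1 : Matrix (Fin n) (Fin n) ℂ) -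
      (ω₁ : ℂ) • (1 + increment A E α β ω₁ ω₂ 0)) = (c * Complex.I) • (A * Ω₁⁻¹ * D) := by
    rw [← Matrix.smul_mul, ← hlin]
    exact (((Commute.one_right D).smul_right _).sub_right
      (((Commute.one_right D).add_right hDC.symm).smul_right _)).eq
  have hsum : β • ((c * Complex.I) • (A * Ω₁⁻¹ * D)) + (Complex.I * α) • (c • (E * Ω₁⁻¹) * D) =
      (c * Complex.I) • (W A E α β * (Ω₁⁻¹ * D)) := by
    rw [W, add_mul, Matrix.smul_mul, Matrix.smul_mul, Matrix.smul_mul, mul_assoc, mul_assoc]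
    module
  rw [hcomm, hCdef, hsum, Matrix.mul_smul,
    Matrix.nonsing_inv_mul_cancel_left _ _ ((Matrix.isUnit_iff_isUnit_det _).mp hW), smul_smul,
    one_div, Complex.inv_I, ← neg_smul]
  congr 1
  ring

end Pencil

end DescriptorPencil

/-! ### The main theorem. -/

open DescriptorPencil Filter in
theorem mainTheorem7 (n : ℕ) (A E : Matrix (Fin n) (Fin n) ℝ) (ω₁ ω₂ : ℝ) (α β : ℂ)
    -- regularity of the pencil, with its witnesses
    (hW : IsUnit (W (toC A) (toC E) α β))
    -- no eigenvalue on the segment from `j ω₁` to `j ω₂`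
    (heig : ∀ t ∈ Set.uIcc ω₁ ω₂, Complex.I * (t : ℂ) ∉ eigenvalues (toC A) (toC E)) :
    -- the integral exists
    (∀ i k, IntervalIntegrable (fun ω : ℝ => K (toC A) (toC E) (Complex.I * (ω : ℂ)) i k)
      MeasureTheory.volume ω₁ ω₂) ∧
    -- the inverses and logarithms under the limits exist for all small `ε ≠ 0`
    (∀ᶠ ε in 𝓝[≠] (0 : ℂ),
      IsUnit (Eeps (toC E) β ε) ∧
      IsUnit (Omega (toC A) (toC E) α β ω₁ ε) ∧
      HasPrincipalLog
        (Omega (toC A) (toC E) α β ω₂ ε * (Omega (toC A) (toC E) α β ω₁ ε)⁻¹) ∧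
      HasPrincipalLog
        ((Omega (toC A) (toC E) α β ω₁ ε)⁻¹ * Omega (toC A) (toC E) α β ω₂ ε)) ∧
    -- the first limit
    Tendsto (fun ε : ℂ => (1 / Complex.I) • ((Eeps (toC E) β ε)⁻¹ *
        principalLog (Omega (toC A) (toC E) α β ω₂ ε * (Omega (toC A) (toC E) α β ω₁ ε)⁻¹)))
      (𝓝[≠] 0)
      (𝓝 (matrixIntegral (fun ω : ℝ => K (toC A) (toC E) (Complex.I * (ω : ℂ))) ω₁ ω₂)) ∧
    -- the second limit
    Tendsto (fun ε : ℂ => (1 / Complex.I) • (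
        principalLog ((Omega (toC A) (toC E) α β ω₁ ε)⁻¹ * Omega (toC A) (toC E) α β ω₂ ε) *
          (Eeps (toC E) β ε)⁻¹))
      (𝓝[≠] 0)
      (𝓝 (matrixIntegral (fun ω : ℝ => K (toC A) (toC E) (Complex.I * (ω : ℂ))) ω₁ ω₂)) ∧
    -- `Y` is well defined and is the limit of `Y_ε`
    IsUnit (Omega (toC A) (toC E) α β ω₁ 0) ∧
    HasPrincipalLog
      (Omega (toC A) (toC E) α β ω₂ 0 * (Omega (toC A) (toC E) α β ω₁ 0)⁻¹) ∧
    Tendsto (Yeps (toC A) (toC E) α β ω₁ ω₂) (𝓝[≠] 0)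
      (𝓝 (Ylim (toC A) (toC E) α β ω₁ ω₂)) ∧
    -- `L = ψ₁(Y)⁻¹` is well defined and is the limit of `(e ^ Y_ε - I)⁻¹ Y_ε`
    IsUnit (psi1 (Ylim (toC A) (toC E) α β ω₁ ω₂)) ∧
    (ω₁ ≠ ω₂ →
      (∀ᶠ ε in 𝓝[≠] (0 : ℂ),
        IsUnit (NormedSpace.exp (Yeps (toC A) (toC E) α β ω₁ ω₂ ε) - 1)) ∧
      Tendsto (fun ε : ℂ =>
          (NormedSpace.exp (Yeps (toC A) (toC E) α β ω₁ ω₂ ε) - 1)⁻¹ *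
            Yeps (toC A) (toC E) α β ω₁ ω₂ ε)
        (𝓝[≠] 0) (𝓝 (L (toC A) (toC E) α β ω₁ ω₂))) ∧
    -- the form without limits
    matrixIntegral (fun ω : ℝ => K (toC A) (toC E) (Complex.I * (ω : ℂ))) ω₁ ω₂ =
      -((W (toC A) (toC E) α β)⁻¹ *
        (β • (L (toC A) (toC E) α β ω₁ ω₂ *
            ((ω₂ : ℂ) • (1 : Matrix (Fin n) (Fin n) ℂ) -
              (ω₁ : ℂ) • NormedSpace.exp (Ylim (toC A) (toC E) α β ω₁ ω₂))) +
          (Complex.I * α) • Ylim (toC A) (toC E) α β ω₁ ω₂)) := by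
  have h : ∀ ω ∈ Set.uIcc ω₁ ω₂, IsUnit (Omega (toC A) (toC E) α β ω 0) := fun ω hω =>
    isUnit_Omega_zero α β (heig ω hω)
  have hE := eventually_isUnit_Eeps hW
  have hΩ : ∀ᶠ ε in 𝓝[≠] (0 : ℂ), ∀ ω ∈ Set.uIcc ω₁ ω₂,
      IsUnit (Omega (toC A) (toC E) α β ω ε) := nhdsWithin_le_nhds (eventually_isUnit_Omega h)
  refine ⟨intervalIntegrable_K h, ?_, ?_, ?_, h ω₁ Set.left_mem_uIcc, hasPrincipalLog_mul_inv h,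
    ?_, ?_, fun hne => ⟨?_, tendsto_inv_exp_sub_one_mul hW h hne⟩, matrixIntegral_K_eq hW h⟩
  · filter_upwards [hE, hΩ] with ε hEε hΩε
    exact ⟨hEε, hΩε ω₁ Set.left_mem_uIcc, hasPrincipalLog_mul_inv hΩε,
      hasPrincipalLog_inv_mul hΩε⟩
  · rw [matrixIntegral_K h]
    refine Tendsto.congr' ?_ ((tendsto_omegaIntegral h).const_smul _)
    filter_upwards [hE, hΩ] with ε hEε hΩε
    rw [principalLog_mul_inv hΩε, Matrix.nonsing_inv_mul_cancel_left _ _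
      ((Matrix.isUnit_iff_isUnit_det _).mp hEε)]
  · rw [matrixIntegral_K h]
    refine Tendsto.congr' ?_ ((tendsto_omegaIntegral h).const_smul _)
    filter_upwards [hE, hΩ] with ε hEε hΩε
    rw [principalLog_inv_mul hΩε, Matrix.mul_nonsing_inv_cancel_right _ _
      ((Matrix.isUnit_iff_isUnit_det _).mp hEε)]
  · have hEc : ContinuousAt (Eeps (toC E) β) 0 := by unfold Eeps; fun_prop
    -- At `ε = 0` the logarithm is still `E_ε` times the integral, with no inverse of `E`, so
    -- continuity of both factors suffices.
    rw [Ylim, Yeps, principalLog_mul_inv h]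
    refine Tendsto.congr' ?_ ((hEc.tendsto.mono_left nhdsWithin_le_nhds).mul
      (tendsto_omegaIntegral h))
    filter_upwards [hΩ] with ε hΩε
    exact (principalLog_mul_inv hΩε).symm
  · exact (Matrix.isUnit_iff_isUnit_det _).mpr
      (Matrix.isUnit_det_of_left_inverse (resolventMean_mul_psi1_Ylim h))
  · filter_upwards [hE, hΩ] with ε hEε hΩε
    rw [exp_Yeps hΩε, add_sub_cancel_left]
    exact isUnit_increment hne hEε (hΩε ω₁ Set.left_mem_uIcc)
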